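/- For $\tau$ in the upper half-plane let $\eta(\tau)=e^{\pi i\tau/12}\prod_{n\ge 1}(1-e^{2\pi i n\tau})$ be the Dedekind eta function, and put $$g_2(\tau)=\left(\frac{\eta(2\tau)}{\eta(\tau)}\right)^{24},\qquad g_8(\tau)=\frac{\eta(8\tau)^4\,\eta(2\tau)^2}{\eta(4\tau)^2\,\eta(\tau)^4}$$ (these are the functions known as Hauptmoduln for $\Gamma_0(2)$ and $\Gamma_0(8)$, respectively). Both functions are invariant under $\tau\mapsto\tau+1$. For $q=e^{2\pi i\tau}$ write $G_2(q)=g_2(\tau)$ and $G_8(q)=g_8(\tau)$, and extend $G_2$ and $G_8$ from $0<|q|<1$ to $q=0$ by their limits there. Then $$g_2(\tau)=g_8(\tau)+20\,g_8(\tau)^2+128\,g_8(\tau)^3+256\,g_8(\tau)^4$$ for every $\tau$ in the upper half-plane; that is, $$G_2(q)=G_8(q)+20\,G_8(q)^2+128\,G_8(q)^3+256\,G_8(q)^4$$ for every complex $q$ with $|q|<1$. -/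

import Mathlib

/-- The eta-quotient `g₂(τ) = (η(2τ) / η(τ)) ^ 24`, a Hauptmodul for `Γ₀(2)`. -/
noncomputable def g2 (τ : ℂ) : ℂ :=
  (ModularForm.eta (2 * τ) / ModularForm.eta τ) ^ 24

/-- The eta-quotient `g₈(τ) = η(8τ)⁴ η(2τ)² / (η(4τ)² η(τ)⁴)`, a Hauptmodul for `Γ₀(8)`. -/
noncomputable def g8 (τ : ℂ) : ℂ :=
  (ModularForm.eta (8 * τ) ^ 4 * ModularForm.eta (2 * τ) ^ 2) /
    (ModularForm.eta (4 * τ) ^ 2 * ModularForm.eta τ ^ 4)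

/-- `g₂` as a function of `q = exp(2πiτ)`: `G₂(q) = g₂(τ)` for `0 < |q| < 1` (see `G2_exp`), with
the limit as `q → 0` as its value at `q = 0`. -/
noncomputable def G2 : ℂ → ℂ := Function.Periodic.cuspFunction 1 g2

/-- `g₈` as a function of `q = exp(2πiτ)`: `G₈(q) = g₈(τ)` for `0 < |q| < 1` (see `G8_exp`), with
the limit as `q → 0` as its value at `q = 0`. -/
noncomputable def G8 : ℂ → ℂ := Function.Periodic.cuspFunction 1 g8

/-- `η(z + n) = exp(2πi/24)ⁿ η(z)`. -/
theorem eta_add_natCast (z : ℂ) (n : ℕ) :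
    ModularForm.eta (z + n) =
      Complex.exp (2 * Real.pi * Complex.I / 24) ^ n * ModularForm.eta z := by
  have h1 : Function.Periodic.qParam 1 (z + n) = Function.Periodic.qParam 1 z := by
    rw [Function.Periodic.qParam, Function.Periodic.qParam, Complex.exp_eq_exp_iff_exists_int]
    refine ⟨n, ?_⟩
    push_cast
    ring
  have h2 : Function.Periodic.qParam 24 (z + n) =
      Complex.exp (2 * Real.pi * Complex.I / 24) ^ n * Function.Periodic.qParam 24 z := by
    rw [Function.Periodic.qParam, Function.Periodic.qParam, ← Complex.exp_nat_mul,
      ← Complex.exp_add]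
    congr 1
    push_cast
    ring
  simp only [ModularForm.eta, ModularForm.eta_q, h1, h2, mul_assoc]

theorem exp_pow_twentyFour : Complex.exp (2 * Real.pi * Complex.I / 24) ^ 24 = 1 := by
  rw [← Complex.exp_nat_mul, ← Complex.exp_two_pi_mul_I]
  congr 1
  push_cast
  ring

theorem g2_periodic : Function.Periodic g2 ((1 : ℝ) : ℂ) := by
  intro z
  have h1 := eta_add_natCast z 1
  have h2 := eta_add_natCast (2 * z) 2
  have e2 : 2 * (z + ((1 : ℝ) : ℂ)) = 2 * z + (2 : ℕ) := by push_cast; ring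
  have e1 : z + ((1 : ℝ) : ℂ) = z + (1 : ℕ) := by push_cast; ring
  have hc := exp_pow_twentyFour
  rw [g2, g2, e2, e1, h1, h2]
  generalize Complex.exp (2 * Real.pi * Complex.I / 24) = c at hc
  rw [div_pow, div_pow, mul_pow, mul_pow, ← pow_mul, ← pow_mul, mul_comm 2 24, mul_comm 1 24,
    pow_mul, pow_mul, hc]
  simp

theorem g8_periodic : Function.Periodic g8 ((1 : ℝ) : ℂ) := by
  intro z
  have h1 := eta_add_natCast z 1
  have h2 := eta_add_natCast (2 * z) 2
  have h4 := eta_add_natCast (4 * z) 4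
  have h8 := eta_add_natCast (8 * z) 8
  have e8 : 8 * (z + ((1 : ℝ) : ℂ)) = 8 * z + (8 : ℕ) := by push_cast; ring
  have e4 : 4 * (z + ((1 : ℝ) : ℂ)) = 4 * z + (4 : ℕ) := by push_cast; ring
  have e2 : 2 * (z + ((1 : ℝ) : ℂ)) = 2 * z + (2 : ℕ) := by push_cast; ring
  have e1 : z + ((1 : ℝ) : ℂ) = z + (1 : ℕ) := by push_cast; ring
  have hc := exp_pow_twentyFour
  have h0 : Complex.exp (2 * Real.pi * Complex.I / 24) ≠ 0 := Complex.exp_ne_zero _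
  rw [g8, g8, e8, e4, e2, e1, h1, h2, h4, h8]
  generalize Complex.exp (2 * Real.pi * Complex.I / 24) = c at hc h0
  generalize ModularForm.eta (8 * z) = x
  generalize ModularForm.eta (4 * z) = y
  generalize ModularForm.eta (2 * z) = u
  generalize ModularForm.eta z = v
  have n : (c ^ 8 * x) ^ 4 * (c ^ 2 * u) ^ 2 = c ^ 12 * (x ^ 4 * u ^ 2) := by
    linear_combination (c ^ 12 * (x ^ 4 * u ^ 2)) * hc
  have d : (c ^ 4 * y) ^ 2 * (c ^ 1 * v) ^ 4 = c ^ 12 * (y ^ 2 * v ^ 4) := by ring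
  rw [n, d, mul_div_mul_left _ _ (pow_ne_zero 12 h0)]

theorem G2_exp (τ : ℂ) : G2 (Complex.exp (2 * Real.pi * Complex.I * τ)) = g2 τ := by
  have h := Function.Periodic.eq_cuspFunction one_ne_zero g2_periodic τ
  simpa [G2, Function.Periodic.qParam] using h

theorem G8_exp (τ : ℂ) : G8 (Complex.exp (2 * Real.pi * Complex.I * τ)) = g8 τ := by
  have h := Function.Periodic.eq_cuspFunction one_ne_zero g8_periodic τ
  simpa [G8, Function.Periodic.qParam] using h

open Filter Topology

/-! Write θ for `thetaSq`, ψ for `thetaPronic` and x for g₈. The quartic factors as x(1 + 4x)(1 +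
8x)², and both nontrivial factors are squares of theta quotients: 1 + 4x = θ(q²)²/θ(-q)² and 1 + 8x
= θ(q)²/θ(-q)². These follow from 4x = qψ(q²)²/θ(-q)² and the identity θ(q)² = θ(q²)² + qψ(q²)²
(`thetaSq_sq`), used at q and at -q. The Jacobi triple product (`tsum_zpow_sq_mul_zpow`) turns each
theta series into a quotient of Euler products. Substituting these, the factored quartic collapses
to g₂ (`eulerProd_quotient_eq`). -/

theorem HasSum.congr_terms {ι : Type*} {f g : ι → ℂ} {a : ℂ} (hf : HasSum f a)
    (h : ∀ i, g i = f i) : HasSum g a :=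
  (funext h : g = f) ▸ hf

/-! ### The Jacobi triple product, as a limit of finite identities. -/

/-- The reciprocal of the finite product `∏ k < m, (1 - x ^ (k + 1))`, extended by zero to negative
integers `m`. -/
noncomputable def invPochhammer (x : ℂ) (m : ℤ) : ℂ :=
  if m < 0 then 0 else (∏ k ∈ Finset.range m.toNat, (1 - x ^ (k + 1)))⁻¹

theorem one_sub_pow_succ_ne_zero {x : ℂ} (hx : ‖x‖ < 1) (k : ℕ) : 1 - x ^ (k + 1) ≠ 0 := by
  intro h
  have h1 : ‖x ^ (k + 1)‖ = 1 := by rw [← sub_eq_zero.mp h, norm_one]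
  rw [norm_pow] at h1
  exact (pow_lt_one₀ (norm_nonneg x) hx k.succ_ne_zero).ne h1

/-- The extension by zero is consistent at m = 0, where 1 - x ^ 0 vanishes. The recursion thus holds
at every integer, and sums over j need no boundary cases. -/
theorem invPochhammer_sub_one {x : ℂ} (hx : ‖x‖ < 1) (m : ℤ) :
    invPochhammer x (m - 1) = (1 - x ^ m) * invPochhammer x m := by
  rcases lt_trichotomy m 0 with h | rfl | h
  · rw [invPochhammer, invPochhammer, if_pos h, if_pos (by omega), mul_zero]
  · simp [invPochhammer]
  · obtain ⟨n, rfl⟩ : ∃ n : ℕ, m = n + 1 := ⟨(m - 1).toNat, by omega⟩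
    have e : ((n : ℤ) + 1).toNat = n + 1 := by omega
    have hz : x ^ ((n : ℤ) + 1) = x ^ (n + 1) := by norm_cast
    rw [invPochhammer, invPochhammer, if_neg (by omega), if_neg (by omega), add_sub_cancel_right,
      Int.toNat_natCast, e, Finset.prod_range_succ, hz, mul_inv_rev,
      mul_inv_cancel_left₀ (one_sub_pow_succ_ne_zero hx n)]

theorem tprod_one_sub_pow_ne_zero {x : ℂ} (hx : ‖x‖ < 1) : ∏' k : ℕ, (1 - x ^ (k + 1)) ≠ 0 := by
  refine tprod_one_add_ne_zero_of_summable (f := fun k : ℕ ↦ -x ^ (k + 1)) (fun k ↦ ?_) ?_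
  · simpa [← sub_eq_add_neg] using one_sub_pow_succ_ne_zero hx k
  · simpa using (summable_nat_add_iff 1).mpr (summable_geometric_of_lt_one (norm_nonneg _) hx)

theorem tendsto_prod_one_sub_pow {x : ℂ} (hx : ‖x‖ < 1) :
    Tendsto (fun n ↦ ∏ k ∈ Finset.range n, (1 - x ^ (k + 1))) atTop
      (𝓝 (∏' k : ℕ, (1 - x ^ (k + 1)))) :=
  (ModularForm.multipliable_one_sub_pow hx).hasProd.tendsto_prod_nat

theorem tendsto_invPochhammer {x : ℂ} (hx : ‖x‖ < 1) :
    Tendsto (invPochhammer x) atTop (𝓝 (∏' k : ℕ, (1 - x ^ (k + 1)))⁻¹) := by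
  have ht : Tendsto Int.toNat atTop atTop :=
    tendsto_atTop.mpr fun b ↦ (eventually_ge_atTop (b : ℤ)).mono fun m hm ↦ by omega
  have h := ((tendsto_prod_one_sub_pow hx).inv₀ (tprod_one_sub_pow_ne_zero hx)).comp ht
  refine h.congr' ?_
  filter_upwards [eventually_ge_atTop 0] with m hm
  simp [invPochhammer, not_lt.mpr hm]

theorem exists_norm_invPochhammer_le {x : ℂ} (hx : ‖x‖ < 1) :
    ∃ C, ∀ m, ‖invPochhammer x m‖ ≤ C := by
  obtain ⟨C, hC⟩ := ((tendsto_prod_one_sub_pow hx).inv₀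
    (tprod_one_sub_pow_ne_zero hx)).norm.bddAbove_range
  have hC' : ∀ n : ℕ, ‖(∏ k ∈ Finset.range n, (1 - x ^ (k + 1)))⁻¹‖ ≤ C :=
    fun n ↦ hC (Set.mem_range_self n)
  refine ⟨C, fun m ↦ ?_⟩
  rw [invPochhammer]
  split_ifs
  · simpa using (norm_nonneg _).trans (hC' 0)
  · exact hC' _

theorem summable_zpow_sq_mul_zpow {q z : ℂ} (hq0 : q ≠ 0) (hq : ‖q‖ < 1) (hz : z ≠ 0) :
    Summable fun j : ℤ ↦ q ^ (j ^ 2) * z ^ j := by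
  have hpi : (Real.pi : ℂ) ≠ 0 := by simp [Real.pi_ne_zero]
  -- These are the terms of the two-variable theta function at τ = log q / (πi), and Im τ = -log ‖q‖
  -- / π > 0.
  have h := (summable_jacobiTheta₂_term_iff (Complex.log z / (2 * Real.pi * Complex.I))
    (Complex.log q / (Real.pi * Complex.I))).mpr ?_
  · refine h.congr fun j ↦ ?_
    have e : 2 * Real.pi * Complex.I * j * (Complex.log z / (2 * Real.pi * Complex.I)) +
        Real.pi * Complex.I * j ^ 2 * (Complex.log q / (Real.pi * Complex.I)) =
        ((j ^ 2 : ℤ) : ℂ) * Complex.log q + (j : ℂ) * Complex.log z := by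
      have := Complex.I_ne_zero
      push_cast
      field_simp
      ring
    rw [jacobiTheta₂_term, e, Complex.exp_add, Complex.exp_int_mul, Complex.exp_int_mul,
      Complex.exp_log hq0, Complex.exp_log hz]
  · have e : Complex.log q / (Real.pi * Complex.I) =
        ((Real.pi⁻¹ : ℝ) : ℂ) * (-Complex.I * Complex.log q) := by
      rw [div_eq_mul_inv, mul_inv, Complex.inv_I]
      push_cast
      ring
    rw [e, Complex.im_ofReal_mul]
    have hl := Real.log_neg (norm_pos_iff.mpr hq0) hq
    have : (-Complex.I * Complex.log q).im = -Real.log ‖q‖ := by simp [Complex.log_re]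
    rw [this]
    exact mul_pos (inv_pos.mpr Real.pi_pos) (neg_pos.mpr hl)

/-- Algebraic core of the induction for the finite triple product: it compares coefficients of z ^
j, with w = q ^ (2n), x = q ^ (2j), and A, B the reciprocal products at n + 1 - j and n + 1 + j. -/
theorem zpow_sq_mul_sub_eq {q w x A B : ℂ} (hx : x ≠ 0) :
    (1 - w ^ 2 * q ^ 2) * (1 - w ^ 2 * q ^ 4) * (A * B) =
      (1 + w ^ 2 * q ^ 2) * ((1 - w * q ^ 2 / x) * A * ((1 - w * q ^ 2 * x) * B)) +
      w * q ^ 2 / x * (A * ((1 - w * x) * ((1 - w * q ^ 2 * x) * B))) +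
      w * q ^ 2 * x * ((1 - w / x) * ((1 - w * q ^ 2 / x) * A) * B) := by
  field_simp
  ring

/-- A finite form of the Jacobi triple product. -/
theorem hasSum_zpow_sq_mul_invPochhammer {q z : ℂ} (hq0 : q ≠ 0) (hq : ‖q‖ < 1) (hz : z ≠ 0)
    (n : ℕ) :
    HasSum (fun j : ℤ ↦ q ^ (j ^ 2) * z ^ j *
        (invPochhammer (q ^ 2) (n - j) * invPochhammer (q ^ 2) (n + j)))
      ((∏ k ∈ Finset.range n, (1 + z * q ^ (2 * k + 1)) * (1 + z⁻¹ * q ^ (2 * k + 1))) /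
        ∏ k ∈ Finset.range (2 * n), (1 - (q ^ 2) ^ (k + 1))) := by
  have hq2 : ‖q ^ 2‖ < 1 := by
    rw [norm_pow]
    exact pow_lt_one₀ (norm_nonneg _) hq two_ne_zero
  induction n with
  | zero =>
    convert hasSum_single (f := fun j : ℤ ↦ q ^ (j ^ 2) * z ^ j *
      (invPochhammer (q ^ 2) ((0 : ℕ) - j) * invPochhammer (q ^ 2) ((0 : ℕ) + j))) 0 ?_ using 1
    · simp [invPochhammer]
    · intro j hj
      rcases hj.lt_or_gt with h | h <;> simp [invPochhammer, h]
  | succ n ih =>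
    set T : ℤ → ℂ := fun j ↦ q ^ (j ^ 2) * z ^ j *
        (invPochhammer (q ^ 2) (n - j) * invPochhammer (q ^ 2) (n + j)) with hT
    have h1 := one_sub_pow_succ_ne_zero hq2 (2 * n)
    have h2 := one_sub_pow_succ_ne_zero hq2 (2 * n + 1)
    -- With v = q ^ (2n + 1), the new factor is (1 + zv)(1 + z⁻¹v) = 1 + v² + zv + z⁻¹v. Shifting
    -- the index by one absorbs the z and the z⁻¹.
    have ha := (Equiv.subRight (1 : ℤ)).hasSum_iff.mpr ih
    have hb := (Equiv.addRight (1 : ℤ)).hasSum_iff.mpr ih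
    have hs := (((ih.mul_left (1 + (q ^ (2 * n + 1)) ^ 2)).add
      (ha.mul_left (z * q ^ (2 * n + 1)))).add (hb.mul_left (z⁻¹ * q ^ (2 * n + 1)))).div_const
      ((1 - (q ^ 2) ^ (2 * n + 1)) * (1 - (q ^ 2) ^ (2 * n + 1 + 1)))
    have hzz : z * z⁻¹ = 1 := mul_inv_cancel₀ hz
    have hv : (1 + z * q ^ (2 * n + 1)) * (1 + z⁻¹ * q ^ (2 * n + 1)) =
        1 + (q ^ (2 * n + 1)) ^ 2 + z * q ^ (2 * n + 1) + z⁻¹ * q ^ (2 * n + 1) := by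
      linear_combination (q ^ (2 * n + 1)) ^ 2 * hzz
    have e : 2 * (n + 1) = 2 * n + 1 + 1 := by ring
    rw [← add_mul, ← add_mul, ← hv, ← mul_div_assoc, div_div] at hs
    rw [e, Finset.prod_range_succ, Finset.prod_range_succ _ (2 * n + 1), Finset.prod_range_succ,
      mul_comm (∏ k ∈ Finset.range n, _), mul_assoc (∏ k ∈ Finset.range (2 * n), _)]
    refine hs.congr_terms fun j ↦ ?_
    · rw [eq_div_iff (mul_ne_zero h1 h2)]
      simp only [Function.comp_apply, Equiv.subRight_apply, Equiv.coe_addRight, hT]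
      have hA := invPochhammer_sub_one hq2 (n + 1 - j)
      have hA' := invPochhammer_sub_one hq2 (n - j)
      have hB := invPochhammer_sub_one hq2 (n + 1 + j)
      have hB' := invPochhammer_sub_one hq2 (n + j)
      have e1 : (n : ℤ) + 1 - j - 1 = n - j := by ring
      have e2 : (n : ℤ) + 1 + j - 1 = n + j := by ring
      have e3 : (n : ℤ) - (j - 1) = n + 1 - j := by ring
      have e4 : (n : ℤ) + (j - 1) = n + j - 1 := by ring
      have e5 : (n : ℤ) - (j + 1) = n - j - 1 := by ring
      have e6 : (n : ℤ) + (j + 1) = n + 1 + j := by ring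
      rw [e1] at hA
      rw [e2] at hB
      rw [hA] at hA'
      rw [hB] at hB'
      push_cast
      rw [e3, e4, e5, e6, hA', hB', hA, hB]
      have hq20 : q ^ 2 ≠ 0 := pow_ne_zero 2 hq0
      have f1 : q ^ ((j - 1) ^ 2) = q ^ (j ^ 2) * q / (q ^ 2) ^ j := by
        rw [← zpow_natCast q 2, ← zpow_mul, ← zpow_add_one₀ hq0, ← zpow_sub₀ hq0]
        congr 1
        push_cast
        ring
      have f2 : q ^ ((j + 1) ^ 2) = q ^ (j ^ 2) * q * (q ^ 2) ^ j := by
        rw [← zpow_natCast q 2, ← zpow_mul, ← zpow_add_one₀ hq0, ← zpow_add₀ hq0]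
        congr 1
        push_cast
        ring
      have g1 : (q ^ 2) ^ ((n : ℤ) + 1 - j) = q ^ (2 * n) * q ^ 2 / (q ^ 2) ^ j := by
        rw [zpow_sub₀ hq20, zpow_add_one₀ hq20, zpow_natCast, pow_mul]
      have g2 : (q ^ 2) ^ ((n : ℤ) + 1 + j) = q ^ (2 * n) * q ^ 2 * (q ^ 2) ^ j := by
        rw [zpow_add₀ hq20, zpow_add_one₀ hq20, zpow_natCast, pow_mul]
      have g3 : (q ^ 2) ^ ((n : ℤ) - j) = q ^ (2 * n) / (q ^ 2) ^ j := by
        rw [zpow_sub₀ hq20, zpow_natCast, pow_mul]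
      have g4 : (q ^ 2) ^ ((n : ℤ) + j) = q ^ (2 * n) * (q ^ 2) ^ j := by
        rw [zpow_add₀ hq20, zpow_natCast, pow_mul]
      have k1 : (q ^ 2) ^ (2 * n + 1) = (q ^ (2 * n)) ^ 2 * q ^ 2 := by ring
      have k2 : (q ^ 2) ^ (2 * n + 1 + 1) = (q ^ (2 * n)) ^ 2 * q ^ 4 := by ring
      have k3 : q ^ (2 * n + 1) = q ^ (2 * n) * q := pow_succ _ _
      rw [f1, f2, g1, g2, g3, g4, k1, k2, k3, zpow_sub_one₀ hz, zpow_add_one₀ hz]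
      have key := zpow_sq_mul_sub_eq (q := q) (w := q ^ (2 * n))
        (A := invPochhammer (q ^ 2) (n + 1 - j)) (B := invPochhammer (q ^ 2) (n + 1 + j))
        (zpow_ne_zero j hq20)
      generalize (q ^ 2) ^ j = x at *
      generalize q ^ j ^ 2 = y at *
      generalize q ^ (2 * n) = w at *
      generalize invPochhammer (q ^ 2) (n + 1 - j) = A at *
      generalize invPochhammer (q ^ 2) (n + 1 + j) = B at *
      linear_combination (y * z ^ j) * key - (w * q ^ 2 / x * (A * ((1 - w * x) *
        ((1 - w * q ^ 2 * x) * B))) + w * q ^ 2 * x * ((1 - w / x) *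
        ((1 - w * q ^ 2 / x) * A) * B)) * (y * z ^ j) * hzz

/-- The **Jacobi triple product** identity. -/
theorem tsum_zpow_sq_mul_zpow {q z : ℂ} (hq0 : q ≠ 0) (hq : ‖q‖ < 1) (hz : z ≠ 0) :
    ∑' j : ℤ, q ^ (j ^ 2) * z ^ j = (∏' k : ℕ, (1 - (q ^ 2) ^ (k + 1))) *
      ((∏' k : ℕ, (1 + z * q ^ (2 * k + 1))) * ∏' k : ℕ, (1 + z⁻¹ * q ^ (2 * k + 1))) := by
  have hq2 : ‖q ^ 2‖ < 1 := by
    rw [norm_pow]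
    exact pow_lt_one₀ (norm_nonneg _) hq two_ne_zero
  have hP := tprod_one_sub_pow_ne_zero hq2
  obtain ⟨C, hC⟩ := exists_norm_invPochhammer_le hq2
  -- As n → ∞ both reciprocal products tend to 1/P, with P = ∏ (1 - q ^ (2k)) over k ≥ 1, and they
  -- are uniformly bounded, so the finite identity becomes (sum)/P² = (product)/P.
  have hlim := tendsto_tsum_of_dominated_convergence (𝓕 := atTop)
    (f := fun (n : ℕ) (j : ℤ) ↦ q ^ (j ^ 2) * z ^ j *
        (invPochhammer (q ^ 2) (n - j) * invPochhammer (q ^ 2) (n + j)))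
    ((summable_zpow_sq_mul_zpow hq0 hq hz).norm.mul_right (C * C))
    (fun j ↦ (((tendsto_invPochhammer hq2).comp (tendsto_atTop_add_const_right atTop (-j)
      tendsto_natCast_atTop_atTop)).mul ((tendsto_invPochhammer hq2).comp
      (tendsto_atTop_add_const_right atTop j tendsto_natCast_atTop_atTop))).const_mul _)
    (Eventually.of_forall fun n j ↦ by
      rw [norm_mul, norm_mul (invPochhammer _ _)]
      exact mul_le_mul_of_nonneg_left (mul_le_mul (hC _) (hC _) (norm_nonneg _)
        ((norm_nonneg _).trans (hC 0))) (norm_nonneg _))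
  simp only [(hasSum_zpow_sq_mul_invPochhammer hq0 hq hz _).tsum_eq, tsum_mul_right] at hlim
  have hm (w : ℂ) : Multipliable fun k : ℕ ↦ 1 + w * q ^ (2 * k + 1) := by
    refine multipliable_one_add_of_summable ?_
    have := (summable_geometric_of_lt_one (norm_nonneg _) hq2).mul_left (‖w‖ * ‖q‖)
    refine this.congr fun k ↦ ?_
    rw [norm_mul, norm_pow, norm_pow]
    ring
  have hprod := ((hm z).tendsto_prod_tprod_nat.mul (hm z⁻¹).tendsto_prod_tprod_nat).div
    ((tendsto_prod_one_sub_pow hq2).comp (tendsto_id.const_mul_atTop' two_pos)) hP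
  have := tendsto_nhds_unique hlim (hprod.congr fun n ↦ by
    simp [Finset.prod_mul_distrib])
  rw [← mul_inv, ← div_eq_mul_inv, div_eq_div_iff (mul_ne_zero hP hP) hP] at this
  apply mul_right_cancel₀ hP
  linear_combination this

/-! ### Theta series as quotients of Euler products. -/

/-- Euler's product `∏ (1 - x ^ k)` over `k ≥ 1`. -/
noncomputable def eulerProd (x : ℂ) : ℂ := ∏' k : ℕ, (1 - x ^ (k + 1))

/-- The theta series `∑ q ^ (j ^ 2)` over all integers `j`. -/
noncomputable def thetaSq (q : ℂ) : ℂ := ∑' j : ℤ, q ^ (j ^ 2)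

/-- The theta series `∑ q ^ (j ^ 2 + j)` over all integers `j`. -/
noncomputable def thetaPronic (q : ℂ) : ℂ := ∑' j : ℤ, q ^ (j ^ 2) * q ^ j

theorem norm_pow_lt_one {q : ℂ} (hq : ‖q‖ < 1) {n : ℕ} (hn : n ≠ 0) : ‖q ^ n‖ < 1 := by
  rw [norm_pow]
  exact pow_lt_one₀ (norm_nonneg _) hq hn

theorem multipliable_one_add_mul_pow {x : ℂ} (hx : ‖x‖ < 1) (w : ℂ) :
    Multipliable fun k : ℕ ↦ 1 + w * x ^ k := by
  refine multipliable_one_add_of_summable ?_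
  simpa using (summable_geometric_of_lt_one (norm_nonneg _) hx).mul_left ‖w‖

theorem tprod_one_add_pow_mul_eulerProd {x : ℂ} (hx : ‖x‖ < 1) :
    (∏' k : ℕ, (1 + x ^ (k + 1))) * eulerProd x = eulerProd (x ^ 2) := by
  have h : Multipliable fun k : ℕ ↦ 1 + x ^ (k + 1) :=
    (multipliable_one_add_mul_pow hx x).congr fun k ↦ by ring
  rw [eulerProd, ← h.tprod_mul (ModularForm.multipliable_one_sub_pow hx), eulerProd]
  exact tprod_congr fun k ↦ by ring

theorem tprod_odd_mul_tprod_even {q w : ℂ} (hq : ‖q‖ < 1) :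
    (∏' k : ℕ, (1 + w * q ^ (2 * k + 1))) * ∏' k : ℕ, (1 + w * (q ^ 2) ^ (k + 1)) =
      ∏' k : ℕ, (1 + w * q ^ (k + 1)) := by
  have hq2 : ‖q ^ 2‖ < 1 := norm_pow_lt_one hq two_ne_zero
  have ho : Multipliable fun k : ℕ ↦ 1 + w * q ^ (2 * k + 1) :=
    (multipliable_one_add_mul_pow hq2 (w * q)).congr fun k ↦ by ring
  have he : Multipliable fun k : ℕ ↦ 1 + w * q ^ (2 * k + 1 + 1) :=
    (multipliable_one_add_mul_pow hq2 (w * q ^ 2)).congr fun k ↦ by ring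
  rw [← tprod_even_mul_odd (f := fun k : ℕ ↦ 1 + w * q ^ (k + 1)) ho he]
  congr 1
  exact tprod_congr fun k ↦ by ring

theorem eulerProd_ne_zero {x : ℂ} (hx : ‖x‖ < 1) : eulerProd x ≠ 0 := tprod_one_sub_pow_ne_zero hx

theorem thetaSq_eq_tprod {q : ℂ} (hq0 : q ≠ 0) (hq : ‖q‖ < 1) :
    thetaSq q = eulerProd (q ^ 2) * (∏' k : ℕ, (1 + q ^ (2 * k + 1))) ^ 2 := by
  simpa [thetaSq, eulerProd, sq] using tsum_zpow_sq_mul_zpow hq0 hq one_ne_zero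

/-- With E for `eulerProd`, splitting ∏ (1 + q ^ k) by the parity of k gives ∏ (1 + q ^ (2k + 1)) =
E(q²)² / (E(q) E(q⁴)). -/
theorem thetaSq_eq {q : ℂ} (hq0 : q ≠ 0) (hq : ‖q‖ < 1) :
    thetaSq q = eulerProd (q ^ 2) ^ 5 / (eulerProd q ^ 2 * eulerProd (q ^ 4) ^ 2) := by
  have hq2 : ‖q ^ 2‖ < 1 := norm_pow_lt_one hq two_ne_zero
  have h1 := tprod_one_add_pow_mul_eulerProd hq
  have h2 := tprod_one_add_pow_mul_eulerProd hq2
  have h3 := tprod_odd_mul_tprod_even (w := 1) hq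
  simp only [one_mul] at h3
  have e4 : (q ^ 2) ^ 2 = q ^ 4 := by ring
  rw [e4] at h2
  have n1 := eulerProd_ne_zero hq
  have n2 := eulerProd_ne_zero hq2
  have n4 := eulerProd_ne_zero (norm_pow_lt_one hq four_ne_zero)
  rw [thetaSq_eq_tprod hq0 hq, eq_div_iff (by positivity)]
  generalize (∏' k : ℕ, (1 + q ^ (2 * k + 1))) = u at *
  have h : u * eulerProd (q ^ 4) * eulerProd q = eulerProd (q ^ 2) ^ 2 := by
    rw [← h2, ← h1, ← h3]
    ring
  linear_combination eulerProd (q ^ 2) * (u * eulerProd (q ^ 4) * eulerProd q +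
    eulerProd (q ^ 2) ^ 2) * h

/-- Under q ↦ -q the odd-power product becomes ∏ (1 - q ^ (2k + 1)) = E(q) / E(q²), with E for
`eulerProd`. -/
theorem thetaSq_neg_eq {q : ℂ} (hq0 : q ≠ 0) (hq : ‖q‖ < 1) :
    thetaSq (-q) = eulerProd q ^ 2 / eulerProd (q ^ 2) := by
  have n2 := eulerProd_ne_zero (norm_pow_lt_one hq two_ne_zero)
  have h := tprod_odd_mul_tprod_even (w := -1) hq
  simp only [neg_one_mul, ← sub_eq_add_neg] at h
  have e : (∏' k : ℕ, (1 + (-q) ^ (2 * k + 1))) = ∏' k : ℕ, (1 - q ^ (2 * k + 1)) :=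
    tprod_congr fun k ↦ by rw [(odd_two_mul_add_one k).neg_pow, sub_eq_add_neg]
  rw [thetaSq_eq_tprod (neg_ne_zero.mpr hq0) (by rwa [norm_neg]), e, neg_sq, eq_div_iff n2,
    eulerProd, eulerProd, ← h]
  ring

theorem thetaPronic_eq {q : ℂ} (hq0 : q ≠ 0) (hq : ‖q‖ < 1) :
    thetaPronic q = 2 * eulerProd (q ^ 4) ^ 2 / eulerProd (q ^ 2) := by
  have hq2 : ‖q ^ 2‖ < 1 := norm_pow_lt_one hq two_ne_zero
  have n2 := eulerProd_ne_zero hq2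
  have h := tprod_one_add_pow_mul_eulerProd hq2
  have e4 : (q ^ 2) ^ 2 = q ^ 4 := by ring
  have e1 : (∏' k : ℕ, (1 + q * q ^ (2 * k + 1))) = ∏' k : ℕ, (1 + (q ^ 2) ^ (k + 1)) :=
    tprod_congr fun k ↦ by ring
  -- The exponents drop to 2k, and the factor k = 0 contributes the 2.
  have e2 : (∏' k : ℕ, (1 + q⁻¹ * q ^ (2 * k + 1))) = 2 * ∏' k : ℕ, (1 + (q ^ 2) ^ (k + 1)) := by
    have hm : Multipliable fun k : ℕ ↦ 1 + (q ^ 2) ^ (k + 1) :=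
      (multipliable_one_add_mul_pow hq2 (q ^ 2)).congr fun k ↦ by ring
    have h0 := tprod_eq_zero_mul' (f := fun k : ℕ ↦ 1 + (q ^ 2) ^ k) hm
    rw [pow_zero, one_add_one_eq_two] at h0
    rw [← h0]
    refine tprod_congr fun k ↦ ?_
    rw [pow_succ', inv_mul_cancel_left₀ hq0, pow_mul]
  rw [thetaPronic, tsum_zpow_sq_mul_zpow hq0 hq hq0, e1, e2, eq_div_iff n2, ← e4, ← h, eulerProd]
  ring

theorem summable_zpow_sq {q : ℂ} (hq0 : q ≠ 0) (hq : ‖q‖ < 1) :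
    Summable fun j : ℤ ↦ q ^ (j ^ 2) := by
  simpa using summable_zpow_sq_mul_zpow hq0 hq one_ne_zero

/-! ### The quadratic theta relation and the resulting eta-quotient identity. -/

theorem hasSum_mul_self_of_summable {f : ℤ → ℂ} (hf : Summable f) :
    HasSum (fun p : ℤ × ℤ ↦ f p.1 * f p.2) ((∑' j, f j) ^ 2) := by
  rw [sq, tsum_mul_tsum_of_summable_norm hf.norm hf.norm]
  exact (summable_mul_of_summable_norm hf.norm hf.norm).hasSum

/-- Split the pairs (m, n) in the double series of q ^ (m² + n²) by the parity of m + n. Even pairs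
are (a + b, a - b), with m² + n² = 2a² + 2b²; odd pairs are (a + b + 1, a - b), with m² + n² = 2(a²
+ a) + 2(b² + b) + 1. -/
theorem thetaSq_sq {q : ℂ} (hq0 : q ≠ 0) (hq : ‖q‖ < 1) :
    thetaSq q ^ 2 = thetaSq (q ^ 2) ^ 2 + q * thetaPronic (q ^ 2) ^ 2 := by
  have hq20 : q ^ 2 ≠ 0 := pow_ne_zero 2 hq0
  have hq2 : ‖q ^ 2‖ < 1 := norm_pow_lt_one hq two_ne_zero
  have h := hasSum_mul_self_of_summable (summable_zpow_sq hq0 hq)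
  have he := hasSum_mul_self_of_summable (summable_zpow_sq hq20 hq2)
  have ho := (hasSum_mul_self_of_summable (summable_zpow_sq_mul_zpow hq20 hq2 hq20)).mul_left q
  set F : ℤ × ℤ → ℂ := fun p ↦ q ^ (p.1 ^ 2) * q ^ (p.2 ^ 2) with hF
  let e : ℤ × ℤ → ℤ × ℤ := fun p ↦ (p.1 + p.2, p.1 - p.2)
  let o : ℤ × ℤ → ℤ × ℤ := fun p ↦ (p.1 + p.2 + 1, p.1 - p.2)
  have hei : e.Injective := by
    rintro ⟨a, b⟩ ⟨c, d⟩ hh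
    simp only [e, Prod.mk.injEq] at hh ⊢
    omega
  have hoi : o.Injective := by
    rintro ⟨a, b⟩ ⟨c, d⟩ hh
    simp only [o, Prod.mk.injEq] at hh ⊢
    omega
  have hc : IsCompl (Set.range e) (Set.range o) := by
    refine ⟨Set.disjoint_left.mpr ?_, codisjoint_iff_le_sup.mpr ?_⟩
    · rintro _ ⟨⟨a, b⟩, rfl⟩ ⟨⟨c, d⟩, hh⟩
      simp only [e, o, Prod.mk.injEq] at hh
      omega
    · rintro ⟨m, n⟩ -
      rcases Int.even_or_odd' (m + n) with ⟨k, hk | hk⟩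
      · exact Or.inl ⟨(k, m - k), by simp only [e, Prod.mk.injEq]; omega⟩
      · exact Or.inr ⟨(k, m - 1 - k), by simp only [o, Prod.mk.injEq]; omega⟩
  have he' : HasSum (F ∘ e) (thetaSq (q ^ 2) ^ 2) := by
    refine he.congr_terms fun p ↦ ?_
    simp only [Function.comp_apply, hF, e]
    rw [← zpow_natCast q 2, ← zpow_mul, ← zpow_mul, ← zpow_add₀ hq0, ← zpow_add₀ hq0]
    congr 1
    push_cast
    ring
  have ho' : HasSum (F ∘ o) (q * thetaPronic (q ^ 2) ^ 2) := by
    refine ho.congr_terms fun p ↦ ?_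
    simp only [Function.comp_apply, hF, o]
    rw [← zpow_natCast q 2, ← zpow_mul, ← zpow_mul, ← zpow_mul, ← zpow_mul, ← zpow_add₀ hq0,
      ← zpow_add₀ hq0, ← zpow_add₀ hq0, ← zpow_add₀ hq0, ← zpow_one_add₀ hq0]
    congr 1
    push_cast
    ring
  exact h.unique ((hei.hasSum_range_iff.mpr he').add_isCompl hc (hoi.hasSum_range_iff.mpr ho'))

theorem eulerProd_quotient_eq {q : ℂ} (hq0 : q ≠ 0) (hq : ‖q‖ < 1) {x : ℂ}
    (hx : x = q * (eulerProd (q ^ 8) ^ 4 * eulerProd (q ^ 2) ^ 2) /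
      (eulerProd (q ^ 4) ^ 2 * eulerProd q ^ 4)) :
    q * (eulerProd (q ^ 2) / eulerProd q) ^ 24 = x + 20 * x ^ 2 + 128 * x ^ 3 + 256 * x ^ 4 := by
  have hq20 : q ^ 2 ≠ 0 := pow_ne_zero 2 hq0
  have hq2 : ‖q ^ 2‖ < 1 := norm_pow_lt_one hq two_ne_zero
  have n1 := eulerProd_ne_zero hq
  have n2 := eulerProd_ne_zero hq2
  have n4 := eulerProd_ne_zero (norm_pow_lt_one hq four_ne_zero)
  have n8 := eulerProd_ne_zero (norm_pow_lt_one hq (n := 8) (by norm_num))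
  have hpos := thetaSq_sq hq0 hq
  -- At -q the theta values on the right, being taken at q², are unchanged; only the sign of the odd
  -- part flips.
  have hneg := thetaSq_sq (neg_ne_zero.mpr hq0) (by rwa [norm_neg])
  have e4 : (q ^ 2) ^ 2 = q ^ 4 := by ring
  have e8 : (q ^ 2) ^ 4 = q ^ 8 := by ring
  rw [neg_sq, thetaSq_neg_eq hq0 hq] at hneg
  rw [thetaSq_eq hq0 hq] at hpos
  rw [thetaPronic_eq hq20 hq2, thetaSq_eq hq20 hq2, e4, e8] at hpos hneg
  generalize eulerProd q = a at *
  generalize eulerProd (q ^ 2) = b at *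
  generalize eulerProd (q ^ 4) = c at *
  generalize eulerProd (q ^ 8) = d at *
  -- Here b / a ^ 2 is 1/θ(-q), c ^ 5 / (b ^ 2 * d ^ 2) is θ(q²) and 2 * d ^ 2 / c is ψ(q²): the
  -- relation at -q is divided by θ(-q)².
  have h4 : 1 + 4 * x = (c ^ 5 / (b ^ 2 * d ^ 2)) ^ 2 * (b / a ^ 2) ^ 2 := by
    have : 4 * x = q * (2 * d ^ 2 / c) ^ 2 * (b / a ^ 2) ^ 2 := by
      rw [hx]
      field_simp
      ring
    have h1 : (1 : ℂ) = (a ^ 2 / b) ^ 2 * (b / a ^ 2) ^ 2 := by field_simp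
    linear_combination this + h1 + (b / a ^ 2) ^ 2 * hneg
  -- The relation at q, divided by θ(-q)², adds another 4x to 1 + 4x.
  have h8 : 1 + 8 * x = (b ^ 5 / (a ^ 2 * c ^ 2)) ^ 2 * (b / a ^ 2) ^ 2 := by
    have : 4 * x = q * (2 * d ^ 2 / c) ^ 2 * (b / a ^ 2) ^ 2 := by
      rw [hx]
      field_simp
      ring
    linear_combination this + h4 - (b / a ^ 2) ^ 2 * hpos
  have hfac : x + 20 * x ^ 2 + 128 * x ^ 3 + 256 * x ^ 4 = x * (1 + 4 * x) * (1 + 8 * x) ^ 2 := by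
    ring
  rw [hfac, h4, h8, hx]
  field_simp

/-! ### From Euler products back to eta quotients, and the value at the cusp. -/

theorem eta_nat_mul_eq (n : ℕ) (τ : ℂ) :
    ModularForm.eta (n * τ) = Complex.exp (2 * Real.pi * Complex.I * τ / 24) ^ n *
      eulerProd (Complex.exp (2 * Real.pi * Complex.I * τ) ^ n) := by
  rw [ModularForm.eta, eulerProd, ← Complex.exp_nat_mul, ← Complex.exp_nat_mul]
  congr 1
  · rw [Function.Periodic.qParam]
    congr 1
    push_cast
    ring
  · refine tprod_congr fun k ↦ ?_
    rw [ModularForm.eta_q_eq_pow]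
    congr 3
    ring

theorem g2_eq (τ : ℂ) :
    g2 τ = Complex.exp (2 * Real.pi * Complex.I * τ) *
      (eulerProd (Complex.exp (2 * Real.pi * Complex.I * τ) ^ 2) /
        eulerProd (Complex.exp (2 * Real.pi * Complex.I * τ))) ^ 24 := by
  have h1 := eta_nat_mul_eq 1 τ
  have h2 := eta_nat_mul_eq 2 τ
  have hr0 := Complex.exp_ne_zero (2 * Real.pi * Complex.I * τ / 24)
  have hr : Complex.exp (2 * Real.pi * Complex.I * τ) =
      Complex.exp (2 * Real.pi * Complex.I * τ / 24) ^ 24 := by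
    rw [← Complex.exp_nat_mul]
    congr 1
    push_cast
    ring
  simp only [Nat.cast_one, Nat.cast_ofNat, one_mul, pow_one] at h1 h2
  rw [g2, h1, h2, sq, mul_assoc, mul_div_mul_left _ _ hr0, mul_div_assoc, mul_pow, ← hr]

theorem g8_eq (τ : ℂ) :
    g8 τ = Complex.exp (2 * Real.pi * Complex.I * τ) *
      (eulerProd (Complex.exp (2 * Real.pi * Complex.I * τ) ^ 8) ^ 4 *
        eulerProd (Complex.exp (2 * Real.pi * Complex.I * τ) ^ 2) ^ 2) /
      (eulerProd (Complex.exp (2 * Real.pi * Complex.I * τ) ^ 4) ^ 2 *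
        eulerProd (Complex.exp (2 * Real.pi * Complex.I * τ)) ^ 4) := by
  have h1 := eta_nat_mul_eq 1 τ
  have h2 := eta_nat_mul_eq 2 τ
  have h4 := eta_nat_mul_eq 4 τ
  have h8 := eta_nat_mul_eq 8 τ
  have hr0 := Complex.exp_ne_zero (2 * Real.pi * Complex.I * τ / 24)
  have hr : Complex.exp (2 * Real.pi * Complex.I * τ) =
      Complex.exp (2 * Real.pi * Complex.I * τ / 24) ^ 24 := by
    rw [← Complex.exp_nat_mul]
    congr 1
    push_cast
    ring
  simp only [Nat.cast_one, Nat.cast_ofNat, one_mul, pow_one] at h1 h2 h4 h8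
  rw [g8, h1, h2, h4, h8]
  generalize eulerProd (Complex.exp (2 * Real.pi * Complex.I * τ)) = a
  generalize eulerProd (Complex.exp (2 * Real.pi * Complex.I * τ) ^ 2) = b
  generalize eulerProd (Complex.exp (2 * Real.pi * Complex.I * τ) ^ 4) = c
  generalize eulerProd (Complex.exp (2 * Real.pi * Complex.I * τ) ^ 8) = d
  rw [hr]
  generalize Complex.exp (2 * Real.pi * Complex.I * τ / 24) = r at hr0
  -- The powers of r are 36 above and 12 below, leaving r ^ 24 = q.
  have hn : (r ^ 8 * d) ^ 4 * (r ^ 2 * b) ^ 2 = r ^ 12 * (r ^ 24 * (d ^ 4 * b ^ 2)) := by ring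
  have hd : (r ^ 4 * c) ^ 2 * (r * a) ^ 4 = r ^ 12 * (c ^ 2 * a ^ 4) := by ring
  rw [hn, hd, mul_div_mul_left _ _ (pow_ne_zero 12 hr0)]

theorem continuousAt_eulerProd_pow_zero {n : ℕ} (hn : n ≠ 0) :
    ContinuousAt (fun q ↦ eulerProd (q ^ n)) 0 := by
  have h : ContinuousAt eulerProd (0 ^ n) := by
    rw [zero_pow hn]
    exact (ModularForm.differentiableOn_tprod_one_sub_pow.differentiableAt
      (Metric.ball_mem_nhds 0 one_pos)).continuousAt
  exact h.comp (f := fun q : ℂ ↦ q ^ n) (continuous_pow n).continuousAt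

theorem eulerProd_zero : eulerProd 0 = 1 := by simp [eulerProd]

theorem tendsto_exp_two_pi_I_comap_im :
    Tendsto (fun τ ↦ Complex.exp (2 * Real.pi * Complex.I * τ)) (comap Complex.im atTop) (𝓝 0) := by
  refine ((Function.Periodic.qParam_tendsto one_pos).mono_right nhdsWithin_le_nhds).congr
    fun τ ↦ ?_
  simp [Function.Periodic.qParam]

/-- The factor q forces the limit 0, since the Euler products are continuous at 0 with value 1
there. -/
theorem G2_zero : G2 0 = 0 := by
  refine Function.Periodic.cuspFunction_zero_of_zero_at_inf one_pos ?_
  have h1 := continuousAt_eulerProd_pow_zero one_ne_zero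
  have h2 := continuousAt_eulerProd_pow_zero two_ne_zero
  have h : ContinuousAt (fun q ↦ q * (eulerProd (q ^ 2) / eulerProd (q ^ 1)) ^ 24) 0 :=
    continuousAt_id.mul ((h2.div h1 (by simp [eulerProd_zero])).pow 24)
  have ht := h.tendsto
  rw [zero_mul] at ht
  refine (ht.comp tendsto_exp_two_pi_I_comap_im).congr fun τ ↦ ?_
  rw [g2_eq, Function.comp_apply, pow_one]

theorem G8_zero : G8 0 = 0 := by
  refine Function.Periodic.cuspFunction_zero_of_zero_at_inf one_pos ?_
  have h1 := continuousAt_eulerProd_pow_zero one_ne_zero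
  have h2 := continuousAt_eulerProd_pow_zero two_ne_zero
  have h4 := continuousAt_eulerProd_pow_zero four_ne_zero
  have h8 := continuousAt_eulerProd_pow_zero (n := 8) (by norm_num)
  have h : ContinuousAt (fun q ↦ q * (eulerProd (q ^ 8) ^ 4 * eulerProd (q ^ 2) ^ 2) /
      (eulerProd (q ^ 4) ^ 2 * eulerProd (q ^ 1) ^ 4)) 0 :=
    (continuousAt_id.mul ((h8.pow 4).mul (h2.pow 2))).div ((h4.pow 2).mul (h1.pow 4))
      (by simp [eulerProd_zero])
  have ht := h.tendsto
  rw [zero_mul, zero_div] at ht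
  refine (ht.comp tendsto_exp_two_pi_I_comap_im).congr fun τ ↦ ?_
  rw [g8_eq, Function.comp_apply, pow_one]

theorem mainTheorem8 :
    (∀ τ : ℂ, 0 < τ.im → g2 τ = g8 τ + 20 * g8 τ ^ 2 + 128 * g8 τ ^ 3 + 256 * g8 τ ^ 4) ∧
    (∀ q : ℂ, ‖q‖ < 1 → G2 q = G8 q + 20 * G8 q ^ 2 + 128 * G8 q ^ 3 + 256 * G8 q ^ 4) := by
  have main (τ : ℂ) (hq : ‖Complex.exp (2 * Real.pi * Complex.I * τ)‖ < 1) :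
      g2 τ = g8 τ + 20 * g8 τ ^ 2 + 128 * g8 τ ^ 3 + 256 * g8 τ ^ 4 := by
    rw [g2_eq]
    exact eulerProd_quotient_eq (Complex.exp_ne_zero _) hq (g8_eq τ)
  refine ⟨fun τ hτ ↦ main τ ?_, fun q hq ↦ ?_⟩
  · simpa [Function.Periodic.qParam] using Function.Periodic.norm_qParam_lt_one one_pos hτ
  · rcases eq_or_ne q 0 with rfl | hq0
    · simp [G2_zero, G8_zero]
    · obtain ⟨τ, rfl⟩ : ∃ τ, Complex.exp (2 * Real.pi * Complex.I * τ) = q :=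
        ⟨Complex.log q / (2 * Real.pi * Complex.I), by
          rw [mul_div_cancel₀ _ Complex.two_pi_I_ne_zero, Complex.exp_log hq0]⟩
      rw [G2_exp, G8_exp]
      exact main τ hq
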